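/- Let $\bar\Lambda=\mathbb C[p_0,p_1,p_2,\dots]$ be the commutative algebra over $\mathbb C$ with free generators $p_i$, $i\ge 0$ (the algebra of symmetric functions, freely generated by the power sums $p_1,p_2,\dots$, with an additional variable $p_0$ adjoined), and let $k\in\mathbb C$. On $\bar\Lambda[x]$ consider - the derivation $\partial$ over $\mathbb C$ with $\partial(x)=x$ and $\partial(p_l)=l\,x^l$ for $l\ge 0$; - the $\bar\Lambda$-linear operator $\Delta$ with $\Delta(1)=0$ and $$\Delta(x^l)=x^lp_0+2x^{l-1}p_1+\dots+2x\,p_{l-1}+p_l-2l\,x^l,\qquad l>0;$$ - the infinite-dimensional Dunkl–Heckman operator $D_k=\partial-\tfrac12 k\Delta$. Let $E:\bar\Lambda[x]\to\bar\Lambda$ be the $\bar\Lambda$-linear map with $E(x^l)=p_l$ for $l\ge 0$, and define $\mathcal L^{(r)}:\bar\Lambda\to\bar\Lambda$, $r\in\mathbb Z_{\ge 0}$, as the restriction of $E\circ D_k^r$ to $\bar\Lambda\subset\bar\Lambda[x]$. Then: 1. the operators $\mathcal L^{(r)}$ commute: $[\mathcal L^{(r)},\mathcal L^{(s)}]=0$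 for all $r,s\ge 0$; 2. $\mathcal L^{(2)}$ is the trigonometric Calogero–Moser–Sutherland operator at infinity, $$\mathcal L^{(2)}=\sum_{a,b>0}p_{a+b}\partial_a\partial_b-k\sum_{a,b>0}p_ap_b\,\partial_{a+b}+(1+k)\sum_{a>0}a\,p_a\partial_a-k\,p_0\sum_{a>0}p_a\partial_a,$$ where $\partial_a=a\,\frac{\partial}{\partial p_a}$ (each sum is finite when applied to an element of $\bar\Lambda$). -/

import Mathlib

open Polynomial

noncomputable section

namespace DunklHeckman

/-- The algebra `Λ̄ = Λ[p₀]` over `ℂ`: the commutative algebra with free generators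
`p i = MvPolynomial.X i`, `i ≥ 0` (`p₀` is an additional variable). -/
abbrev LambdaBar : Type := MvPolynomial ℕ ℂ

/-- The free generators (power sums) `p₀, p₁, p₂, …` of `Λ̄`. -/
abbrev p (l : ℕ) : LambdaBar := MvPolynomial.X l

/-- The restriction to `Λ̄` of the differentiation `∂`: the derivation `Λ̄ → Λ̄[x]` with
`p l ↦ l x ^ l`. -/
def partialCoeff : Derivation ℂ LambdaBar LambdaBar[X] :=
  MvPolynomial.mkDerivation ℂ fun l => (l : LambdaBar[X]) * X ^ l

/-- The `ℂ`-linear map `x ^ l f ↦ l x ^ l f + x ^ l ∂ f`, `f ∈ Λ̄`, underlying `∂`. -/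
def partialLin : LambdaBar[X] →ₗ[ℂ] LambdaBar[X] :=
  Polynomial.lsum fun l =>
    (LinearMap.mulLeft ℂ ((l : LambdaBar[X]) * X ^ l)) ∘ₗ
        (Polynomial.CAlgHom (R := ℂ) (A := LambdaBar)).toLinearMap
      + (LinearMap.mulLeft ℂ ((X : LambdaBar[X]) ^ l)) ∘ₗ
        (partialCoeff : LambdaBar →ₗ[ℂ] LambdaBar[X])

theorem partialLin_monomial (l : ℕ) (f : LambdaBar) :
    partialLin (monomial l f) = (l : LambdaBar[X]) * X ^ l * C f + X ^ l * partialCoeff f := by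
  simp [partialLin, Polynomial.lsum_apply, Polynomial.sum_monomial_index]
  ring

theorem partialLin_mul (u v : LambdaBar[X]) :
    partialLin (u * v) = u • partialLin v + v • partialLin u := by
  induction u using Polynomial.induction_on' with
  | add a b ha hb => rw [add_mul, map_add, ha, hb, map_add]; simp only [smul_eq_mul]; ring
  | monomial m f =>
    induction v using Polynomial.induction_on' with
    | add a b ha hb => rw [mul_add, map_add, ha, hb, map_add]; simp only [smul_eq_mul]; ring
    | monomial n g =>
      rw [Polynomial.monomial_mul_monomial, partialLin_monomial, partialLin_monomial,
        partialLin_monomial, Derivation.leibniz]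
      simp only [← Polynomial.C_mul_X_pow_eq_monomial, smul_eq_mul, Polynomial.smul_eq_C_mul,
        map_mul]
      push_cast
      ring

/-- The differentiation `∂` of `Λ̄[x]`: the derivation over `ℂ` with `∂ x = x` and
`∂ (p l) = l x ^ l`. -/
def partialD : Derivation ℂ LambdaBar[X] LambdaBar[X] :=
  Derivation.mk' partialLin partialLin_mul

theorem partialD_X : partialD X = X := by
  change partialLin X = X
  rw [← Polynomial.monomial_one_one_eq_X, partialLin_monomial]
  simp [Polynomial.monomial_one_one_eq_X]

theorem partialD_p (l : ℕ) : partialD (C (p l)) = (l : LambdaBar[X]) * X ^ l := by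
  change partialLin (monomial 0 (p l)) = _
  rw [partialLin_monomial]
  simp [partialCoeff, p]

/-- `Δ(x ^ l)`: zero for `l = 0`, and
`x ^ l p₀ + 2 x ^ (l - 1) p₁ + ⋯ + 2 x p_{l-1} + p_l - 2 l x ^ l` for `l > 0`. -/
def deltaPow (l : ℕ) : LambdaBar[X] :=
  if l = 0 then 0
  else X ^ l * C (p 0) + 2 * ∑ i ∈ Finset.Ico 1 l, X ^ (l - i) * C (p i) + C (p l)
    - 2 * (l : LambdaBar[X]) * X ^ l

/-- The `Λ̄`-linear operator `Δ` on `Λ̄[x]`, `Δ(x ^ l f) = Δ(x ^ l) f` for `f ∈ Λ̄`. -/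
def delta : LambdaBar[X] →ₗ[LambdaBar] LambdaBar[X] :=
  Polynomial.lsum fun l => LinearMap.toSpanSingleton LambdaBar LambdaBar[X] (deltaPow l)

/-- The `Λ̄`-linear operator `E : Λ̄[x] → Λ̄`, `E(x ^ l f) = p_l f` for `f ∈ Λ̄`. -/
def E : LambdaBar[X] →ₗ[LambdaBar] LambdaBar :=
  Polynomial.lsum fun l => LinearMap.toSpanSingleton LambdaBar LambdaBar (p l)

/-- The infinite dimensional Dunkl–Heckman operator `D_k = ∂ - (1/2) k Δ` on `Λ̄[x]`. -/
def D (k : ℂ) : Module.End ℂ LambdaBar[X] :=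
  (partialD : LambdaBar[X] →ₗ[ℂ] LambdaBar[X]) - (1 / 2 * k) • delta.restrictScalars ℂ

/-- The operators `ℒ⁽ʳ⁾ = E ∘ D_k ^ r`, restricted to `Λ̄ ⊆ Λ̄[x]`. -/
def L (k : ℂ) (r : ℕ) : Module.End ℂ LambdaBar :=
  E.restrictScalars ℂ ∘ₗ (D k ^ r) ∘ₗ (Polynomial.CAlgHom (R := ℂ) (A := LambdaBar)).toLinearMap

/-- `∂_a = a ∂/∂p_a` on `Λ̄`. -/
def partialP (a : ℕ) (f : LambdaBar) : LambdaBar :=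
  (a : LambdaBar) * MvPolynomial.pderiv a f

/-- The trigonometric CMS operator at infinity,
`∑_{a,b>0} p_{a+b} ∂_a ∂_b - k ∑_{a,b>0} p_a p_b ∂_{a+b} + (1+k) ∑_{a>0} a p_a ∂_a
  - k p₀ ∑_{a>0} p_a ∂_a`.
Applied to any `f ∈ Λ̄`, each of the sums has only finitely many nonzero terms; see
`cms_finite₁`, …, `cms_finite₄`. -/
def cmsInfinity (k : ℂ) (f : LambdaBar) : LambdaBar :=
  (∑ᶠ ab : ℕ+ × ℕ+, p (ab.1 + ab.2) * partialP ab.1 (partialP ab.2 f))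
    - k • (∑ᶠ ab : ℕ+ × ℕ+, p ab.1 * p ab.2 * partialP (ab.1 + ab.2) f)
    + (1 + k) • (∑ᶠ a : ℕ+, ((a : ℕ) : LambdaBar) * p a * partialP a f)
    - k • (p 0 * ∑ᶠ a : ℕ+, p a * partialP a f)

theorem exists_partialP_eq_zero (f : LambdaBar) : ∃ n : ℕ, ∀ a, n < a → partialP a f = 0 := by
  refine ⟨f.vars.sup id, fun a ha => ?_⟩
  have h : a ∉ f.vars := fun h => absurd (Finset.le_sup (f := id) h) (not_le.mpr ha)
  simp [partialP, MvPolynomial.pderiv_eq_zero_of_notMem_vars h]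

theorem cms_finite₁ (f : LambdaBar) : (Function.support fun ab : ℕ+ × ℕ+ =>
    p (ab.1 + ab.2) * partialP ab.1 (partialP ab.2 f)).Finite := by
  obtain ⟨n, hn⟩ := exists_partialP_eq_zero f
  choose m hm using fun b : ℕ => exists_partialP_eq_zero (partialP b f)
  obtain ⟨M, hM⟩ : ∃ M, ∀ b ≤ n, m b ≤ M :=
    ⟨(Finset.range (n + 1)).sup m, fun b hb => Finset.le_sup (f := m) (by simpa using hb)⟩
  refine ((Set.finite_Iic (M.succPNat)).prod (Set.finite_Iic (n.succPNat))).subset ?_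
  rintro ⟨a, b⟩ hab
  have hb : (b : ℕ) ≤ n := by
    by_contra! h
    exact hab (by dsimp only; rw [hn _ h]; simp [partialP])
  have ha : (a : ℕ) ≤ M := by
    by_contra! h
    exact hab (by simp [hm _ _ ((hM _ hb).trans_lt h)])
  exact ⟨PNat.coe_le_coe _ _ |>.mp (by simp; omega), PNat.coe_le_coe _ _ |>.mp (by simp; omega)⟩

theorem cms_finite₂ (f : LambdaBar) : (Function.support fun ab : ℕ+ × ℕ+ =>
    p ab.1 * p ab.2 * partialP (ab.1 + ab.2) f).Finite := by
  obtain ⟨n, hn⟩ := exists_partialP_eq_zero f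
  refine ((Set.finite_Iic (n.succPNat)).prod (Set.finite_Iic (n.succPNat))).subset ?_
  rintro ⟨a, b⟩ hab
  have h : (a + b : ℕ) ≤ n := by
    by_contra! h
    exact hab (by simp [hn _ h])
  exact ⟨PNat.coe_le_coe _ _ |>.mp (by simp; omega), PNat.coe_le_coe _ _ |>.mp (by simp; omega)⟩

theorem cms_finite₃ (f : LambdaBar) : (Function.support fun a : ℕ+ =>
    ((a : ℕ) : LambdaBar) * p a * partialP a f).Finite := by
  obtain ⟨n, hn⟩ := exists_partialP_eq_zero f
  refine (Set.finite_Iic (n.succPNat)).subset fun a ha => ?_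
  have h : (a : ℕ) ≤ n := by
    by_contra! h
    exact ha (by simp [hn _ h])
  exact PNat.coe_le_coe _ _ |>.mp (by simp; omega)

theorem cms_finite₄ (f : LambdaBar) : (Function.support fun a : ℕ+ =>
    p a * partialP a f).Finite := by
  obtain ⟨n, hn⟩ := exists_partialP_eq_zero f
  refine (Set.finite_Iic (n.succPNat)).subset fun a ha => ?_
  have h : (a : ℕ) ≤ n := by
    by_contra! h
    exact ha (by simp [hn _ h])
  exact PNat.coe_le_coe _ _ |>.mp (by simp; omega)

end DunklHeckman

end

/-! The operators are limits of operators in finitely many variables. Specializing `p l` to `∑ i,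
x_i ^ l` (so `p 0` becomes the number of variables) and `x` to `x_i` turns `D k` into Heckman's
operator `dunkl k i`, whose difference part is the sum over j of `(x_i + x_j) / (x_i - x_j) (1 -
s_ij)`, and turns `E` into summation over i. Hence `L k r` becomes `∑ i, dunkl k i ^ r` acting on
symmetric polynomials (`psumHom_L`).

The `dunkl k i` do not commute, but their commutators are multiples of sums of `g - g⁻¹` with g a
permutation (`dunkl_commutator`). Such an element changes sign under the anti-involution that
reverses words and inverts permutations. It follows by induction on length that, between two
symmetrizers, a word equals its reversal (`wordProd_reverse`). Applied to words `D_j ^ r D_i ^ s`,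
this makes the power sums commute on symmetric polynomials.

An element of `LambdaBar` killed by all these specializations is zero
(`eq_zero_of_forall_psumHom_eq_zero`), so commutativity lifts to infinitely many variables.

The formula for `L k 2` is a direct computation: `delta` annihilates constants in `x`, so only `E (D
k (x ^ l ∂_l f))` has to be evaluated. -/

namespace DunklHeckman

/-! ### Reversal of words between symmetrizers -/

section Words

variable {ι A : Type*} [Ring A]

/-- The product of the letters `D i` along a word. -/
def wordProd (D : ι → A) (l : List ι) : A := (l.map D).prod

theorem wordProd_append (D : ι → A) (l m : List ι) :
    wordProd D (l ++ m) = wordProd D l * wordProd D m := by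
  simp [wordProd]

/-- Permutations move through a word at the cost of relabelling its letters; at either end they are
absorbed by `e`. -/
theorem map_mul_wordProd (D : ι → A) (ρ : Equiv.Perm ι →* A)
    (hD : ∀ w i, ρ w * D i = D (w i) * ρ w) (w : Equiv.Perm ι) (l : List ι) :
    ρ w * wordProd D l = wordProd D (l.map w) * ρ w := by
  induction l with
  | nil => simp [wordProd]
  | cons i l ih =>
    simp only [wordProd, List.map_cons, List.prod_cons] at ih ⊢
    rw [← mul_assoc, hD, mul_assoc, ih, mul_assoc]

/-- Between two copies of a `ρ`-invariant element `e`, a word in the letters `D i` may be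
reversed, provided that the commutators of letters are combinations of `ρ g - ρ g⁻¹`. -/
theorem wordProd_reverse [IsAddTorsionFree A] [Fintype ι] (D : ι → A) (ρ : Equiv.Perm ι →* A)
    (hD : ∀ w i, ρ w * D i = D (w i) * ρ w) (e : A) (he : ∀ w, e * ρ w = e)
    (he' : ∀ w, ρ w * e = e) (c : A) (hc : ∀ a, c * a = a * c)
    (g : ι → ι → ι → Equiv.Perm ι)
    (hg : ∀ i j, D i * D j - D j * D i = ∑ m, c * (ρ (g i j m) - ρ (g i j m)⁻¹)) (l : List ι) :
    e * wordProd D l * e = e * wordProd D l.reverse * e := by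
  induction hn : l.length using Nat.strong_induction_on generalizing l with
  | _ n ih =>
  -- Pushing `w` to the outer end leaves a pure word shorter than `n`, to which the induction
  -- hypothesis applies.
  have key : ∀ u v : List ι, u.length + v.length < n → ∀ w : Equiv.Perm ι,
      e * (wordProd D u * ρ w * wordProd D v) * e =
        e * (wordProd D v.reverse * ρ w⁻¹ * wordProd D u.reverse) * e := by
    intro u v huv w
    have h1 : e * (wordProd D u * ρ w * wordProd D v) * e =
        e * wordProd D (u ++ v.map w) * e := by
      rw [mul_assoc _ (ρ w), map_mul_wordProd D ρ hD, wordProd_append]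
      simp only [mul_assoc, he']
    have h2 : e * (wordProd D v.reverse * ρ w⁻¹ * wordProd D u.reverse) * e =
        e * wordProd D ((v.map w).reverse ++ u.reverse) * e := by
      have h3 : wordProd D v.reverse * ρ w⁻¹ = ρ w⁻¹ * wordProd D (v.map w).reverse := by
        rw [map_mul_wordProd D ρ hD, ← List.map_reverse, List.map_map]
        congr 2
        simp [Function.comp_def]
      rw [h3, wordProd_append]
      simp only [← mul_assoc, he]
    rw [h1, h2, ih _ (by simpa using huv) _ rfl, List.reverse_append]
  -- The defect, a word minus its reversal, does not see a swap of adjacent letters: the commutator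
  -- contributes `ρ g - ρ g⁻¹`, and by `key` reversal exchanges these two terms just as it exchanges
  -- the two orders of the letters.
  have swap : ∀ (u v : List ι) (i j : ι), u.length + v.length < n →
      e * wordProd D (u ++ i :: j :: v) * e - e * wordProd D (u ++ i :: j :: v).reverse * e =
        e * wordProd D (u ++ j :: i :: v) * e - e * wordProd D (u ++ j :: i :: v).reverse * e := by
    intro u v i j huv
    have h1 : e * (wordProd D u * (D i * D j - D j * D i) * wordProd D v) * e =
        e * (wordProd D v.reverse * (D j * D i - D i * D j) * wordProd D u.reverse) * e := by
      rw [← neg_sub (D i * D j), hg]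
      simp only [Finset.mul_sum, Finset.sum_mul, ← Finset.sum_neg_distrib]
      refine Finset.sum_congr rfl fun m _ => ?_
      have h3 := key u v huv (g i j m)
      have h4 := key u v huv (g i j m)⁻¹
      rw [inv_inv] at h4
      have h5 : ∀ a b x y : A, e * (a * (c * (x - y)) * b) * e =
          c * (e * (a * x * b) * e - e * (a * y * b) * e) := by
        intro a b x y
        rw [← mul_assoc a c, ← hc a]
        simp only [mul_assoc c]
        rw [← mul_assoc e c, ← hc e]
        noncomm_ring
      rw [← mul_neg, neg_sub, h5, h5, h3, h4]
    simp only [wordProd, List.map_append, List.prod_append, List.map_cons, List.prod_cons,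
      List.reverse_append, List.reverse_cons, List.map_nil, List.prod_nil, mul_one] at h1 ⊢
    rw [← sub_eq_zero] at h1 ⊢
    rw [← h1]
    noncomm_ring
  have perm : ∀ v v' : List ι, v.Perm v' → ∀ u : List ι, u.length + v.length ≤ n →
      e * wordProd D (u ++ v) * e - e * wordProd D (u ++ v).reverse * e =
        e * wordProd D (u ++ v') * e - e * wordProd D (u ++ v').reverse * e := by
    intro v v' h
    induction h with
    | nil => intros; rfl
    | cons i _ ih =>
      intro u hu
      simpa using ih (u ++ [i]) (by simp at hu ⊢; omega)
    | swap i j v => exact fun u hu => swap u v j i (by simp at hu; omega)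
    | trans h _ ih₁ ih₂ =>
      exact fun u hu => (ih₁ u hu).trans (ih₂ u (h.length_eq ▸ hu))
  -- Reversal is itself a permutation of the letters, yet it negates the defect; so twice the defect
  -- is zero.
  have h := perm l l.reverse l.reverse_perm.symm [] (by simp [hn])
  simp only [List.nil_append, List.reverse_reverse] at h
  have h2 : 2 • (e * wordProd D l * e - e * wordProd D l.reverse * e) = 0 := by
    rw [two_nsmul]
    nth_rewrite 2 [h]
    abel
  exact sub_eq_zero.mp ((nsmul_eq_zero_iff_right two_ne_zero).mp h2)

theorem sum_pow_commute_on_invariants [IsAddTorsionFree A] [Fintype ι] (D : ι → A)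
    (ρ : Equiv.Perm ι →* A)
    (hD : ∀ w i, ρ w * D i = D (w i) * ρ w) (e : A) (he : ∀ w, e * ρ w = e)
    (he' : ∀ w, ρ w * e = e) (c : A) (hc : ∀ a, c * a = a * c)
    (g : ι → ι → ι → Equiv.Perm ι)
    (hg : ∀ i j, D i * D j - D j * D i = ∑ m, c * (ρ (g i j m) - ρ (g i j m)⁻¹)) (r s : ℕ) :
    e * ((∑ i, D i ^ r) * ∑ i, D i ^ s) * e = e * ((∑ i, D i ^ s) * ∑ i, D i ^ r) * e := by
  rw [Finset.sum_mul_sum, Finset.sum_mul_sum, Finset.sum_comm]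
  simp only [Finset.mul_sum, Finset.sum_mul]
  refine Finset.sum_congr rfl fun i _ => Finset.sum_congr rfl fun j _ => ?_
  have h := wordProd_reverse D ρ hD e he he' c hc g hg (List.replicate r j ++ List.replicate s i)
  simpa [wordProd] using h

end Words

/-! ### Divided differences in finitely many variables -/

section FiniteDunkl

variable {ι : Type*} [Fintype ι] [DecidableEq ι]

/-- The action of permutations of the variables on polynomials. -/
noncomputable def permRep (ι : Type*) : Equiv.Perm ι →* Module.End ℂ (MvPolynomial ι ℂ) where
  toFun w := (MvPolynomial.rename w).toLinearMap
  map_one' := by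
    refine LinearMap.ext fun f => ?_
    simp
  map_mul' v w := by
    refine LinearMap.ext fun f => ?_
    simp [Module.End.mul_apply, MvPolynomial.rename_rename, Equiv.Perm.coe_mul]

omit [Fintype ι] [DecidableEq ι] in
theorem permRep_apply (w : Equiv.Perm ι) (f : MvPolynomial ι ℂ) :
    permRep ι w f = MvPolynomial.rename w f := rfl

omit [Fintype ι] in
theorem X_sub_X_dvd_sub_swap (i j : ι) (f : MvPolynomial ι ℂ) :
    (MvPolynomial.X i - MvPolynomial.X j) ∣ f - permRep ι (Equiv.swap i j) f := by
  induction f using MvPolynomial.induction_on with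
  | C a => simp [permRep_apply]
  | add f g hf hg =>
    rw [map_add, add_sub_add_comm]
    exact dvd_add hf hg
  | mul_X f n hf =>
    have h : (MvPolynomial.X i - MvPolynomial.X j : MvPolynomial ι ℂ) ∣
        MvPolynomial.X n - MvPolynomial.X (Equiv.swap i j n) := by
      rcases eq_or_ne n i with rfl | hi
      · simp
      rcases eq_or_ne n j with rfl | hj
      · simp [dvd_sub_comm]
      · simp [Equiv.swap_apply_of_ne_of_ne hi hj]
    obtain ⟨u, hu⟩ := h
    obtain ⟨v, hv⟩ := hf
    simp only [permRep_apply, map_mul, MvPolynomial.rename_X] at hv ⊢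
    exact ⟨v * MvPolynomial.X n + MvPolynomial.rename (Equiv.swap i j) f * u, by
      linear_combination MvPolynomial.X n * hv + MvPolynomial.rename (Equiv.swap i j) f * hu⟩

omit [Fintype ι] [DecidableEq ι] in
theorem X_sub_X_ne_zero {i j : ι} (h : i ≠ j) :
    (MvPolynomial.X i - MvPolynomial.X j : MvPolynomial ι ℂ) ≠ 0 :=
  sub_ne_zero.mpr fun h' => h (MvPolynomial.X_injective h')

omit [Fintype ι] in
theorem exists_dividedDiff (i j : ι) : ∃ T : Module.End ℂ (MvPolynomial ι ℂ),
    (∀ f, (MvPolynomial.X i - MvPolynomial.X j) * T f =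
      (MvPolynomial.X i + MvPolynomial.X j) * (f - permRep ι (Equiv.swap i j) f)) ∧
    (i = j → T = 0) := by
  rcases eq_or_ne i j with rfl | hij
  · exact ⟨0, by simp [permRep_apply], fun _ => rfl⟩
  choose q hq using fun f => dvd_mul_of_dvd_right (X_sub_X_dvd_sub_swap i j f)
    (MvPolynomial.X i + MvPolynomial.X j)
  have h0 := X_sub_X_ne_zero hij
  refine ⟨⟨⟨q, fun f g => mul_left_cancel₀ h0 ?_⟩, fun a f => mul_left_cancel₀ h0 ?_⟩,
    fun f => (hq f).symm, fun h => absurd h hij⟩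
  · rw [mul_add, ← hq, ← hq, ← hq, map_add]
    ring
  · rw [RingHom.id_apply, mul_smul_comm, ← hq, ← hq, map_smul, ← smul_sub, mul_smul_comm]

/-- The operator `(xᵢ + xⱼ) / (xᵢ - xⱼ) (1 - sᵢⱼ)` on polynomials, zero for `i = j`. -/
noncomputable def dividedDiff (i j : ι) : Module.End ℂ (MvPolynomial ι ℂ) :=
  (exists_dividedDiff i j).choose

omit [Fintype ι] in
theorem sub_mul_dividedDiff (i j : ι) (f : MvPolynomial ι ℂ) :
    (MvPolynomial.X i - MvPolynomial.X j) * dividedDiff i j f =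
      (MvPolynomial.X i + MvPolynomial.X j) * (f - permRep ι (Equiv.swap i j) f) :=
  (exists_dividedDiff i j).choose_spec.1 f

omit [Fintype ι] in
theorem dividedDiff_self (i : ι) : dividedDiff i i = 0 :=
  (exists_dividedDiff i i).choose_spec.2 rfl

omit [Fintype ι] in
theorem dividedDiff_swap (i j : ι) : dividedDiff j i = -dividedDiff i j := by
  rcases eq_or_ne i j with rfl | hij
  · simp [dividedDiff_self]
  refine LinearMap.ext fun f => mul_left_cancel₀ (X_sub_X_ne_zero hij) ?_
  have h1 := sub_mul_dividedDiff i j f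
  have h2 := sub_mul_dividedDiff j i f
  rw [Equiv.swap_comm] at h2
  rw [LinearMap.neg_apply]
  linear_combination h1 - h2

omit [Fintype ι] in
theorem permRep_mul_dividedDiff (w : Equiv.Perm ι) (i j : ι) :
    permRep ι w * dividedDiff i j = dividedDiff (w i) (w j) * permRep ι w := by
  rcases eq_or_ne i j with rfl | hij
  · simp [dividedDiff_self]
  refine LinearMap.ext fun f => mul_left_cancel₀ (X_sub_X_ne_zero (w.injective.ne hij)) ?_
  rw [Module.End.mul_apply, Module.End.mul_apply, sub_mul_dividedDiff]
  have h := congrArg (permRep ι w) (sub_mul_dividedDiff i j f)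
  simp only [permRep_apply, map_mul, map_sub, map_add, MvPolynomial.rename_X] at h
  rw [← Module.End.mul_apply (permRep ι _) (permRep ι w), ← map_mul,
    ← Equiv.mul_swap_eq_swap_mul, map_mul, Module.End.mul_apply]
  simpa only [permRep_apply] using h

omit [Fintype ι] in
theorem permRep_dividedDiff (w : Equiv.Perm ι) (i j : ι) (f : MvPolynomial ι ℂ) :
    permRep ι w (dividedDiff i j f) = dividedDiff (w i) (w j) (permRep ι w f) :=
  LinearMap.congr_fun (permRep_mul_dividedDiff w i j) f

omit [Fintype ι] in
-- A Yang–Baxter type relation, in which all terms cancel except the two 3-cycles. Degenerate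
-- indices are included so that it can be summed over all `l`; there the permutation is its own
-- inverse and both sides vanish.
theorem dividedDiff_triple (i j l : ι) :
    (dividedDiff i j * dividedDiff j l - dividedDiff j l * dividedDiff i j) +
        (dividedDiff i j * dividedDiff i l - dividedDiff i l * dividedDiff i j) +
        (dividedDiff i l * dividedDiff j l - dividedDiff j l * dividedDiff i l) =
      permRep ι (Equiv.swap i j * Equiv.swap j l) -
        permRep ι (Equiv.swap i j * Equiv.swap j l)⁻¹ := by
  rw [mul_inv_rev, Equiv.swap_inv, Equiv.swap_inv]
  rcases eq_or_ne i j with rfl | hij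
  · simp [dividedDiff_self, ← Equiv.Perm.one_def]
  rcases eq_or_ne j l with rfl | hjl
  · simp [dividedDiff_self, ← Equiv.Perm.one_def]
  rcases eq_or_ne i l with rfl | hil
  · simp [dividedDiff_self, dividedDiff_swap i j, Equiv.swap_comm j i]
    have h : ∀ x : Module.End ℂ (MvPolynomial ι ℂ), x * -x - -x * x = 0 := fun x =>
      sub_eq_zero.mpr ((mul_neg x x).trans (neg_mul x x).symm)
    exact h _
  refine LinearMap.ext fun f => ?_
  simp only [LinearMap.add_apply, LinearMap.sub_apply, Module.End.mul_apply]
  have e1 := sub_mul_dividedDiff i j (dividedDiff j l f)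
  have e2 := sub_mul_dividedDiff j l (dividedDiff i j f)
  have e3 := sub_mul_dividedDiff i j (dividedDiff i l f)
  have e4 := sub_mul_dividedDiff i l (dividedDiff i j f)
  have e5 := sub_mul_dividedDiff i l (dividedDiff j l f)
  have e6 := sub_mul_dividedDiff j l (dividedDiff i l f)
  simp only [permRep_dividedDiff, Equiv.swap_apply_left, Equiv.swap_apply_right,
    Equiv.swap_apply_of_ne_of_ne hij hil, Equiv.swap_apply_of_ne_of_ne hil.symm hjl.symm,
    Equiv.swap_apply_of_ne_of_ne hij.symm hjl, dividedDiff_swap j l, dividedDiff_swap i j,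
    LinearMap.neg_apply]
    at e1 e2 e3 e4 e5 e6
  -- Every product of two distinct transpositions of `i`, `j`, `l` is one of two 3-cycles, here
  -- normalized to `(i j)(j l)` and `(j l)(i j)`.
  have q1 : Equiv.swap i l * Equiv.swap i j = Equiv.swap i j * Equiv.swap j l := by
    rw [Equiv.mul_swap_eq_swap_mul (Equiv.swap i j), Equiv.swap_apply_right,
      Equiv.swap_apply_of_ne_of_ne hil.symm hjl.symm]
  have q2 : Equiv.swap i l * Equiv.swap j l = Equiv.swap j l * Equiv.swap i j := by
    rw [Equiv.mul_swap_eq_swap_mul (Equiv.swap j l), Equiv.swap_apply_left,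
      Equiv.swap_apply_of_ne_of_ne hij hil]
  have q3 : Equiv.swap j l * Equiv.swap i l = Equiv.swap i j * Equiv.swap j l := by
    rw [← q1, Equiv.mul_swap_eq_swap_mul (Equiv.swap i l), Equiv.swap_apply_left,
      Equiv.swap_apply_of_ne_of_ne hij.symm hjl, Equiv.swap_comm l j]
  have q4 : Equiv.swap i j * Equiv.swap i l = Equiv.swap j l * Equiv.swap i j := by
    rw [← q2, Equiv.mul_swap_eq_swap_mul (Equiv.swap i l), Equiv.swap_apply_right,
      Equiv.swap_apply_of_ne_of_ne hij.symm hjl, Equiv.swap_comm j i]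
  have comp : ∀ v w : Equiv.Perm ι, permRep ι v (permRep ι w f) = permRep ι (v * w) f :=
    fun v w => by rw [map_mul, Module.End.mul_apply]
  have f1 := sub_mul_dividedDiff i j f
  have f2 := sub_mul_dividedDiff j l f
  have f3 := sub_mul_dividedDiff i l f
  have a1 := sub_mul_dividedDiff i l (permRep ι (Equiv.swap i j) f)
  have a2 := sub_mul_dividedDiff j l (permRep ι (Equiv.swap i j) f)
  have b1 := sub_mul_dividedDiff i l (permRep ι (Equiv.swap j l) f)
  have b2 := sub_mul_dividedDiff i j (permRep ι (Equiv.swap j l) f)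
  have c1 := sub_mul_dividedDiff j l (permRep ι (Equiv.swap i l) f)
  have c2 := sub_mul_dividedDiff i j (permRep ι (Equiv.swap i l) f)
  rw [comp] at a1 a2 b1 b2 c1 c2
  rw [q1] at a1
  rw [q2] at b1
  rw [q3] at c1
  rw [q4] at c2
  have h1 := X_sub_X_ne_zero hij
  have h2 := X_sub_X_ne_zero hjl
  have h3 := X_sub_X_ne_zero hil
  -- With denominators cleared and the images of `f` treated as independent symbols, this is an
  -- identity in a commutative ring: the `e` equations expand the outer operators, the others the
  -- inner ones.
  refine mul_left_cancel₀ (mul_ne_zero (mul_ne_zero h1 h2) h3) ?_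
  generalize permRep ι (Equiv.swap i j * Equiv.swap j l) f = st at *
  generalize permRep ι (Equiv.swap j l * Equiv.swap i j) f = ts at *
  generalize permRep ι (Equiv.swap i j) f = a at *
  generalize permRep ι (Equiv.swap j l) f = b at *
  generalize permRep ι (Equiv.swap i l) f = c at *
  generalize (MvPolynomial.X i : MvPolynomial ι ℂ) = x at *
  generalize (MvPolynomial.X j : MvPolynomial ι ℂ) = y at *
  generalize (MvPolynomial.X l : MvPolynomial ι ℂ) = z at *
  linear_combination (y - z) * (x - z) * (e1 + e3) - (x - y) * (x - z) * (e2 + e6) +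
    (x - y) * (y - z) * (e5 - e4) + ((x - z) * (x + y) + (x - y) * (x + z)) * f2 -
    (y - z) * (x + y) * a1 + ((y - z) * (x + y) - (x - y) * (y + z)) * f3 -
    (x - z) * (x + y) * a2 - ((x - z) * (y + z) + (y - z) * (x + z)) * f1 +
    (x - y) * (y + z) * b1 + (x - z) * (y + z) * b2 - (x - y) * (x + z) * c1 +
    (y - z) * (x + z) * c2

end FiniteDunkl

/-! ### Commutator identities in an abstract ring -/

section Commutators

variable {ι A : Type*} [Ring A]

/-- Only pairs of operators sharing an index survive: `a = j`, `b = i` or `a = b`. Antisymmetry puts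
the second kind in the stated form, and makes the overlap `a = j`, `b = i` harmless. -/
theorem commutator_sum_of_antisymm [Fintype ι] [DecidableEq ι] (T : ι → ι → A)
    (h0 : ∀ i, T i i = 0) (hT : ∀ i j, T j i = -T i j) {i j : ι} (hij : i ≠ j)
    (hc : ∀ a b, i ≠ b → a ≠ j → a ≠ b → T i a * T j b = T j b * T i a) :
    (∑ a, T i a) * (∑ b, T j b) - (∑ b, T j b) * (∑ a, T i a) =
      ∑ l, ((T i j * T j l - T j l * T i j) + (T i j * T i l - T i l * T i j) +
        (T i l * T j l - T j l * T i l)) := by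
  have h : ∀ a b, T i a * T j b - T j b * T i a =
      (if a = j then T i j * T j b - T j b * T i j else 0) +
      (if b = i then T i j * T i a - T i a * T i j else 0) +
      (if a = b then T i a * T j a - T j a * T i a else 0) := by
    intro a b
    by_cases ha : a = j
    · subst ha
      by_cases hb : b = i
      · subst hb
        simp [hij.symm]
      · by_cases hab : a = b
        · subst hab
          simp [hb, h0]
        · simp [hb, hab]
    · by_cases hb : b = i
      · subst hb
        by_cases hab : a = b
        · subst hab
          simp [ha, h0]
        · simp only [ha, hab, if_false, if_true, zero_add, add_zero]
          rw [hT b j]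
          noncomm_ring
      · by_cases hab : a = b
        · subst hab
          simp [ha, hb]
        · simp [ha, hb, hab, hc a b (Ne.symm hb) ha hab]
  rw [Finset.sum_mul_sum, Finset.sum_mul_sum, Finset.sum_comm (f := fun b a => T j b * T i a)]
  simp only [← Finset.sum_sub_distrib]
  rw [Finset.sum_congr rfl fun a _ => Finset.sum_congr rfl fun b _ => h a b]
  simp only [Finset.sum_add_distrib, Finset.sum_ite_eq, Finset.mem_univ, if_true]
  congr 2
  · rw [Finset.sum_comm]
    simp only [Finset.sum_ite_eq', Finset.mem_univ, if_true]
  · simp only [Finset.sum_ite_eq', Finset.mem_univ, if_true]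

/-- The terms linear in `κ` cancel: they reduce to the commutator of `d + d'` with `T`, which is
zero. -/
theorem commutator_sub_smul {R : Type*} [CommRing R] [Algebra R A] {d d' S S' T T' : A} (κ : R)
    (hd : d * d' = d' * d) (h : d * S' - S' * d = d * T' - T' * d)
    (h' : d' * S - S * d' = d' * T - T * d') (hT : T' = -T)
    (hdT : (d + d') * T = T * (d + d')) :
    (d - κ • S) * (d' - κ • S') - (d' - κ • S') * (d - κ • S) =
      κ ^ 2 • (S * S' - S' * S) := by
  have h5 : d * S' - S' * d - (d' * S - S * d') = 0 := by
    rw [h, h', hT, ← sub_eq_zero.mpr hdT.symm]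
    noncomm_ring
  have h6 := congrArg (fun z => κ • z) h5
  simp only [smul_sub, smul_zero] at h6
  simp only [mul_sub, sub_mul, mul_smul_comm, smul_mul_assoc, smul_sub, smul_smul, hd, ← sq]
  rw [← sub_eq_zero, ← neg_eq_zero, ← h6]
  abel

end Commutators

/-! ### Finite Dunkl–Heckman operators and their commutators -/

section FiniteDunklOperators

variable {ι : Type*} [Fintype ι] [DecidableEq ι]

/-- The Euler derivation `xᵢ ∂/∂xᵢ`. -/
noncomputable def euler (i : ι) : Derivation ℂ (MvPolynomial ι ℂ) (MvPolynomial ι ℂ) :=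
  (MvPolynomial.X i : MvPolynomial ι ℂ) • MvPolynomial.pderiv i

omit [Fintype ι] in
theorem euler_X (i j : ι) : euler i (MvPolynomial.X j : MvPolynomial ι ℂ) =
    if i = j then MvPolynomial.X i else 0 := by
  rw [euler, Derivation.smul_apply, MvPolynomial.pderiv_X, Pi.single_apply, smul_eq_mul]
  simp [eq_comm]

/-- The Euler derivation as a linear map. -/
noncomputable def eulerEnd (i : ι) : Module.End ℂ (MvPolynomial ι ℂ) :=
  (euler i : MvPolynomial ι ℂ →ₗ[ℂ] MvPolynomial ι ℂ)

omit [Fintype ι] [DecidableEq ι] in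
theorem eulerEnd_apply (i : ι) (f : MvPolynomial ι ℂ) : eulerEnd i f = euler i f := rfl

omit [Fintype ι] in
theorem eulerEnd_commute (i j : ι) : eulerEnd i * eulerEnd j = eulerEnd j * eulerEnd i := by
  have h : ⁅euler i, euler j⁆ = 0 := by
    refine MvPolynomial.derivation_ext fun l => ?_
    rw [Derivation.commutator_apply, euler_X, euler_X]
    split_ifs with h1 h2 h2
    · rw [euler_X, euler_X, if_pos (h2.trans h1.symm), if_pos (h1.trans h2.symm)]
      simp [h1, h2]
    · rw [euler_X, if_neg (by rintro rfl; exact h2 h1)]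
      simp
    · rw [euler_X, if_neg (by rintro rfl; exact h1 h2)]
      simp
    · simp
  refine LinearMap.ext fun f => ?_
  have h' := congrArg (fun d => d f) h
  rw [Derivation.commutator_apply] at h'
  exact sub_eq_zero.mp h'

omit [Fintype ι] [DecidableEq ι] in
theorem permRep_mul_eulerEnd (w : Equiv.Perm ι) (i : ι) :
    permRep ι w * eulerEnd i = eulerEnd (w i) * permRep ι w := by
  refine LinearMap.ext fun f => ?_
  simp only [Module.End.mul_apply, permRep_apply, eulerEnd_apply, euler, Derivation.smul_apply,
    smul_eq_mul, map_mul, MvPolynomial.rename_X, MvPolynomial.pderiv_rename w.injective]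

omit [Fintype ι] in
theorem eulerEnd_mul_dividedDiff_of_ne {i j l : ι} (hj : i ≠ j) (hl : i ≠ l) :
    eulerEnd i * dividedDiff j l = dividedDiff j l * eulerEnd i := by
  rcases eq_or_ne j l with rfl | hjl
  · simp [dividedDiff_self]
  refine LinearMap.ext fun f => mul_left_cancel₀ (X_sub_X_ne_zero hjl) ?_
  have h1 := congrArg (euler i) (sub_mul_dividedDiff j l f)
  have h2 := sub_mul_dividedDiff j l (eulerEnd i f)
  have h3 := LinearMap.congr_fun (permRep_mul_eulerEnd (Equiv.swap j l) i) f
  rw [Equiv.swap_apply_of_ne_of_ne hj hl] at h3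
  simp only [Derivation.leibniz, map_sub, map_add, euler_X, if_neg hj, if_neg hl, smul_eq_mul]
    at h1
  simp only [Module.End.mul_apply, eulerEnd_apply] at h2 h3 ⊢
  linear_combination h1 - h2 + (MvPolynomial.X j + MvPolynomial.X l) * h3

omit [Fintype ι] in
-- The sum of the two Euler operators commutes with the transposition and annihilates `(x_i + x_j) /
-- (x_i - x_j)`, which is homogeneous of degree zero.
theorem eulerEnd_add_mul_dividedDiff {i j : ι} :
    (eulerEnd i + eulerEnd j) * dividedDiff i j = dividedDiff i j * (eulerEnd i + eulerEnd j) := by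
  rcases eq_or_ne i j with rfl | hij
  · simp [dividedDiff_self]
  refine LinearMap.ext fun f => mul_left_cancel₀ (X_sub_X_ne_zero hij) ?_
  have h1 := congrArg (euler i) (sub_mul_dividedDiff i j f)
  have h1' := congrArg (euler j) (sub_mul_dividedDiff i j f)
  have h2 := sub_mul_dividedDiff i j (eulerEnd i f + eulerEnd j f)
  have h3 := LinearMap.congr_fun (permRep_mul_eulerEnd (Equiv.swap i j) i) f
  have h3' := LinearMap.congr_fun (permRep_mul_eulerEnd (Equiv.swap i j) j) f
  have h4 := sub_mul_dividedDiff i j f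
  rw [Equiv.swap_apply_left] at h3
  rw [Equiv.swap_apply_right] at h3'
  simp only [Derivation.leibniz, map_sub, map_add, euler_X, if_neg hij, if_neg hij.symm,
    smul_eq_mul, if_true] at h1 h1'
  simp only [Module.End.mul_apply, eulerEnd_apply, LinearMap.add_apply, map_add] at h2 h3 h3' ⊢
  linear_combination h1 + h1' - h2 + (MvPolynomial.X i + MvPolynomial.X j) * (h3 + h3') - h4

/-- The Dunkl–Heckman operator of the variable `xᵢ` in finitely many variables. -/
noncomputable def dunkl (k : ℂ) (i : ι) : Module.End ℂ (MvPolynomial ι ℂ) :=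
  eulerEnd i - (1 / 2 * k) • ∑ j, dividedDiff i j

theorem permRep_mul_dunkl (k : ℂ) (w : Equiv.Perm ι) (i : ι) :
    permRep ι w * dunkl k i = dunkl k (w i) * permRep ι w := by
  rw [dunkl, dunkl, mul_sub, sub_mul, permRep_mul_eulerEnd, mul_smul_comm, smul_mul_assoc,
    Finset.mul_sum, Finset.sum_mul, ← Equiv.sum_comp w (fun j => dividedDiff (w i) j * _)]
  simp only [permRep_mul_dividedDiff]

omit [Fintype ι] in
theorem dividedDiff_commute_of_disjoint {i j a b : ι} (hij : i ≠ j) (hib : i ≠ b) (haj : a ≠ j)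
    (hab : a ≠ b) : dividedDiff i a * dividedDiff j b = dividedDiff j b * dividedDiff i a := by
  rcases eq_or_ne i a with rfl | hia
  · simp [dividedDiff_self]
  rcases eq_or_ne j b with rfl | hjb
  · simp [dividedDiff_self]
  refine LinearMap.ext fun f => mul_left_cancel₀
    (mul_ne_zero (X_sub_X_ne_zero hia) (X_sub_X_ne_zero hjb)) ?_
  have e1 := sub_mul_dividedDiff i a (dividedDiff j b f)
  have e2 := sub_mul_dividedDiff j b (dividedDiff i a f)
  rw [permRep_dividedDiff, Equiv.swap_apply_of_ne_of_ne hij.symm haj.symm,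
    Equiv.swap_apply_of_ne_of_ne hib.symm hab.symm] at e1
  rw [permRep_dividedDiff, Equiv.swap_apply_of_ne_of_ne hij hib,
    Equiv.swap_apply_of_ne_of_ne haj hab] at e2
  have f1 := sub_mul_dividedDiff i a f
  have f2 := sub_mul_dividedDiff j b f
  have g1 := sub_mul_dividedDiff i a (permRep ι (Equiv.swap j b) f)
  have g2 := sub_mul_dividedDiff j b (permRep ι (Equiv.swap i a) f)
  have hc : permRep ι (Equiv.swap i a) (permRep ι (Equiv.swap j b) f) =
      permRep ι (Equiv.swap j b) (permRep ι (Equiv.swap i a) f) := by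
    rw [← Module.End.mul_apply, ← Module.End.mul_apply, ← map_mul, ← map_mul,
      Equiv.mul_swap_eq_swap_mul (Equiv.swap i a), Equiv.swap_apply_of_ne_of_ne hij.symm haj.symm,
      Equiv.swap_apply_of_ne_of_ne hib.symm hab.symm]
  simp only [Module.End.mul_apply]
  linear_combination (MvPolynomial.X j - MvPolynomial.X b) * e1 -
    (MvPolynomial.X i - MvPolynomial.X a) * e2 +
    (MvPolynomial.X i + MvPolynomial.X a) * (f2 - g2) -
    (MvPolynomial.X j + MvPolynomial.X b) * (f1 - g1) -
    (MvPolynomial.X i + MvPolynomial.X a) * (MvPolynomial.X j + MvPolynomial.X b) * hc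

theorem commutator_sum_dividedDiff (i j : ι) :
    (∑ a, dividedDiff i a) * (∑ b, dividedDiff j b) -
        (∑ b, dividedDiff j b) * (∑ a, dividedDiff i a) =
      ∑ l, (permRep ι (Equiv.swap i j * Equiv.swap j l) -
        permRep ι (Equiv.swap i j * Equiv.swap j l)⁻¹) := by
  simp only [← dividedDiff_triple]
  rcases eq_or_ne i j with rfl | hij
  · simp [dividedDiff_self]
  exact commutator_sum_of_antisymm dividedDiff dividedDiff_self dividedDiff_swap hij
    (fun a b h1 h2 h3 => dividedDiff_commute_of_disjoint hij h1 h2 h3)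

theorem dunkl_commutator (k : ℂ) (i j : ι) :
    dunkl k i * dunkl k j - dunkl k j * dunkl k i =
      ∑ l, algebraMap ℂ (Module.End ℂ (MvPolynomial ι ℂ)) ((1 / 2 * k) ^ 2) *
        (permRep ι (Equiv.swap i j * Equiv.swap j l) -
        permRep ι (Equiv.swap i j * Equiv.swap j l)⁻¹) := by
  rw [← Finset.mul_sum, ← commutator_sum_dividedDiff, ← Algebra.smul_def]
  rcases eq_or_ne i j with rfl | hij
  · rw [sub_self, sub_self, smul_zero]
  -- The Euler operator of `x_i` commutes with every summand not involving `x_i`, so one term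
  -- remains.
  have h : ∀ i j : ι, i ≠ j →
      eulerEnd i * (∑ b, dividedDiff j b) - (∑ b, dividedDiff j b) * eulerEnd i =
        eulerEnd i * dividedDiff j i - dividedDiff j i * eulerEnd i := by
    intro i j hij
    rw [Finset.mul_sum, Finset.sum_mul, ← Finset.sum_sub_distrib]
    refine Finset.sum_eq_single i (fun b _ hb => ?_) (by simp)
    rw [eulerEnd_mul_dividedDiff_of_ne hij hb.symm, sub_self]
  exact commutator_sub_smul _ (eulerEnd_commute i j) (h i j hij) (h j i hij.symm)
    (dividedDiff_swap i j) eulerEnd_add_mul_dividedDiff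

end FiniteDunklOperators

/-! ### Specialization to finitely many variables -/

section Specialization

variable {ι : Type*} [Fintype ι]

/-- The specialization of the generators to power sums in finitely many variables. -/
noncomputable def psumHom (ι : Type*) [Fintype ι] : LambdaBar →ₐ[ℂ] MvPolynomial ι ℂ :=
  MvPolynomial.aeval fun l => ∑ i, MvPolynomial.X i ^ l

theorem psumHom_p (l : ℕ) : psumHom ι (p l) = ∑ i, MvPolynomial.X i ^ l := by
  simp [psumHom, p]

theorem permRep_psumHom (w : Equiv.Perm ι) (f : LambdaBar) :
    permRep ι w (psumHom ι f) = psumHom ι f := by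
  rw [permRep_apply, ← AlgHom.comp_apply]
  congr 1
  refine MvPolynomial.algHom_ext fun l => ?_
  rw [AlgHom.comp_apply, psumHom_p, map_sum]
  simp only [map_pow, MvPolynomial.rename_X]
  exact Equiv.sum_comp w (fun i => (MvPolynomial.X i : MvPolynomial ι ℂ) ^ l)

/-- The specialization of `x` to the variable `xᵢ`. -/
noncomputable def evalAt (i : ι) : LambdaBar[X] →+* MvPolynomial ι ℂ :=
  Polynomial.eval₂RingHom (psumHom ι : LambdaBar →+* MvPolynomial ι ℂ) (MvPolynomial.X i)

theorem evalAt_C (i : ι) (f : LambdaBar) : evalAt i (C f) = psumHom ι f := by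
  simp [evalAt]

theorem evalAt_X (i : ι) : evalAt i X = MvPolynomial.X i := by
  simp [evalAt]

theorem evalAt_smul (i : ι) (f : LambdaBar) (g : LambdaBar[X]) :
    evalAt i (f • g) = psumHom ι f * evalAt i g := by
  rw [Polynomial.smul_eq_C_mul, map_mul, evalAt_C]

theorem evalAt_smul_complex (i : ι) (a : ℂ) (g : LambdaBar[X]) :
    evalAt i (a • g) = a • evalAt i g := by
  rw [← algebraMap_smul LambdaBar a g, evalAt_smul, AlgHom.commutes, Algebra.smul_def]

theorem evalAt_monomial (i : ι) (l : ℕ) (f : LambdaBar) :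
    evalAt i (monomial l f) = psumHom ι f * MvPolynomial.X i ^ l := by
  rw [← Polynomial.C_mul_X_pow_eq_monomial, map_mul, map_pow, evalAt_C, evalAt_X]

theorem psumHom_E (g : LambdaBar[X]) : psumHom ι (E g) = ∑ i, evalAt i g := by
  induction g using Polynomial.induction_on' with
  | add a b ha hb => simp only [map_add, ha, hb, Finset.sum_add_distrib]
  | monomial l f =>
    simp only [evalAt_monomial, ← Finset.mul_sum, ← psumHom_p, ← map_mul]
    simp [E, Polynomial.lsum_apply, Polynomial.sum_monomial_index]

variable [DecidableEq ι]

theorem evalAt_partialCoeff (i : ι) (f : LambdaBar) :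
    evalAt i (partialCoeff f) = euler i (psumHom ι f) := by
  induction f using MvPolynomial.induction_on with
  | C a => simp [partialCoeff, ← MvPolynomial.algebraMap_eq]
  | add f g hf hg => simp only [map_add, hf, hg]
  | mul_X f l hf =>
    have h : euler i (psumHom ι (p l)) = (l : MvPolynomial ι ℂ) * MvPolynomial.X i ^ l := by
      rw [psumHom_p, map_sum, Finset.sum_eq_single i]
      · rcases l with _ | l
        · simp
        · rw [Derivation.leibniz_pow, euler_X, if_pos rfl]
          simp only [smul_eq_mul, nsmul_eq_mul, Nat.add_sub_cancel, pow_succ]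
      · intro j _ hj
        rw [Derivation.leibniz_pow, euler_X, if_neg hj.symm]
        simp
      · simp
    have h' : partialCoeff (p l) = (l : LambdaBar[X]) * X ^ l := by simp [partialCoeff, p]
    change evalAt i (partialCoeff (f * p l)) = euler i (psumHom ι (f * p l))
    rw [Derivation.leibniz, map_mul, Derivation.leibniz, h, h', map_add, evalAt_smul, evalAt_smul,
      hf]
    simp [evalAt_X]

theorem evalAt_partialD (i : ι) (g : LambdaBar[X]) :
    evalAt i (partialD g) = eulerEnd i (evalAt i g) := by
  change evalAt i (partialLin g) = euler i (evalAt i g)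
  induction g using Polynomial.induction_on' with
  | add a b ha hb => simp only [map_add, ha, hb]
  | monomial l f =>
    rw [partialLin_monomial, evalAt_monomial, Derivation.leibniz, Derivation.leibniz_pow,
      euler_X, if_pos rfl]
    simp only [map_add, map_mul, map_pow, evalAt_X, evalAt_C, evalAt_partialCoeff, map_natCast,
      smul_eq_mul, nsmul_eq_mul]
    rcases l with _ | l
    · simp
    · simp only [Nat.add_sub_cancel]
      ring

omit [DecidableEq ι] in
theorem sub_mul_sum_pow {R : Type*} [CommRing R] (x y : R) (l : ℕ) :
    (x - y) * (x ^ (l + 1) + 2 * ∑ m ∈ Finset.Ico 1 (l + 1), x ^ (l + 1 - m) * y ^ m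
      + y ^ (l + 1)) = (x + y) * (x ^ (l + 1) - y ^ (l + 1)) := by
  induction l with
  | zero => simp; ring
  | succ l ih =>
    have h : ∑ m ∈ Finset.Ico 1 (l + 1 + 1), x ^ (l + 1 + 1 - m) * y ^ m =
        x * ∑ m ∈ Finset.Ico 1 (l + 1), x ^ (l + 1 - m) * y ^ m + x * y ^ (l + 1) := by
      rw [Finset.sum_Ico_succ_top (by omega), Finset.mul_sum]
      congr 1
      · refine Finset.sum_congr rfl fun m hm => ?_
        rw [Nat.sub_add_comm (Finset.mem_Ico.mp hm).2.le, pow_succ]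
        ring
      · simp
    rw [h]
    linear_combination x * ih

omit [Fintype ι] in
-- The case `i = j` explains the term `-2 l x ^ l` of `delta`: the sum over all `j` of the quotient
-- formula also counts the diagonal, where the operator itself is zero.
theorem dividedDiff_X_pow (i j : ι) (l : ℕ) :
    dividedDiff i j (MvPolynomial.X i ^ (l + 1)) =
      MvPolynomial.X i ^ (l + 1) + 2 * ∑ m ∈ Finset.Ico 1 (l + 1),
        MvPolynomial.X i ^ (l + 1 - m) * MvPolynomial.X j ^ m + MvPolynomial.X j ^ (l + 1) -
      if i = j then 2 * ((l + 1 : ℕ) : MvPolynomial ι ℂ) * MvPolynomial.X i ^ (l + 1) else 0 := by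
  rcases eq_or_ne i j with rfl | hij
  · have h : ∀ m ∈ Finset.Ico 1 (l + 1), (MvPolynomial.X i : MvPolynomial ι ℂ) ^ (l + 1 - m) *
        MvPolynomial.X i ^ m = MvPolynomial.X i ^ (l + 1) := by
      intro m hm
      rw [← pow_add, Nat.sub_add_cancel (Finset.mem_Ico.mp hm).2.le]
    rw [Finset.sum_congr rfl h, dividedDiff_self, if_pos rfl]
    simp
    ring
  · refine mul_left_cancel₀ (X_sub_X_ne_zero hij) ?_
    rw [if_neg hij, sub_zero, sub_mul_sum_pow, sub_mul_dividedDiff, permRep_apply, map_pow,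
      MvPolynomial.rename_X, Equiv.swap_apply_left]

omit [Fintype ι] in
theorem dividedDiff_mul_of_invariant (i j : ι) {f : MvPolynomial ι ℂ}
    (hf : permRep ι (Equiv.swap i j) f = f) (g : MvPolynomial ι ℂ) :
    dividedDiff i j (f * g) = f * dividedDiff i j g := by
  rcases eq_or_ne i j with rfl | hij
  · simp [dividedDiff_self]
  refine mul_left_cancel₀ (X_sub_X_ne_zero hij) ?_
  have h := sub_mul_dividedDiff i j g
  rw [sub_mul_dividedDiff]
  rw [permRep_apply] at *
  rw [map_mul, hf]
  linear_combination -f * h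

/-- Coefficients specialize to symmetric polynomials, which pass through divided differences, so
powers of `x` suffice. -/
theorem evalAt_delta (i : ι) (g : LambdaBar[X]) :
    evalAt i (delta g) = (∑ j, dividedDiff i j) (evalAt i g) := by
  induction g using Polynomial.induction_on' with
  | add a b ha hb => simp only [map_add, ha, hb]
  | monomial l f =>
    have h : delta (monomial l f) = f • deltaPow l := by
      simp [delta, Polynomial.lsum_apply, Polynomial.sum_monomial_index]
    rw [h, evalAt_smul, evalAt_monomial, LinearMap.sum_apply]
    simp only [dividedDiff_mul_of_invariant i _ (permRep_psumHom _ f)]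
    rw [← Finset.mul_sum]
    congr 1
    rcases l with _ | l
    · simp only [deltaPow, if_true, map_zero]
      refine (Finset.sum_eq_zero fun j _ => ?_).symm
      rcases eq_or_ne i j with rfl | hij
      · simp [dividedDiff_self]
      · refine (mul_eq_zero_iff_left (X_sub_X_ne_zero hij)).mp ?_
        rw [sub_mul_dividedDiff]
        simp [permRep_apply]
    · simp only [dividedDiff_X_pow, Finset.sum_sub_distrib, Finset.sum_add_distrib,
        ← Finset.mul_sum, Finset.sum_ite_eq, Finset.mem_univ, if_true]
      rw [Finset.sum_comm]
      simp only [deltaPow, Nat.succ_ne_zero, if_false, map_sub, map_add, map_mul, map_sum, map_pow,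
        evalAt_X, evalAt_C, map_natCast, psumHom_p, map_ofNat, ← Finset.mul_sum]
      simp [mul_comm]

theorem evalAt_D (k : ℂ) (i : ι) (g : LambdaBar[X]) :
    evalAt i (D k g) = dunkl k i (evalAt i g) := by
  simp only [D, dunkl, LinearMap.sub_apply, LinearMap.smul_apply, map_sub, evalAt_smul_complex,
    LinearMap.restrictScalars_apply, evalAt_delta, ← evalAt_partialD]
  rfl

theorem evalAt_D_pow (k : ℂ) (i : ι) (r : ℕ) (g : LambdaBar[X]) :
    evalAt i ((D k ^ r) g) = (dunkl k i ^ r) (evalAt i g) := by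
  induction r with
  | zero => simp
  | succ r ih => rw [pow_succ', pow_succ', Module.End.mul_apply, Module.End.mul_apply, evalAt_D, ih]

theorem psumHom_L (k : ℂ) (r : ℕ) (f : LambdaBar) :
    psumHom ι (L k r f) = (∑ i, dunkl k i ^ r) (psumHom ι f) := by
  change psumHom ι (E ((D k ^ r) (C f))) = _
  rw [psumHom_E, LinearMap.sum_apply]
  simp only [evalAt_D_pow, evalAt_C]

/-- The sum of all permutations of the variables. -/
noncomputable def symmetrizer (ι : Type*) [Fintype ι] [DecidableEq ι] :
    Module.End ℂ (MvPolynomial ι ℂ) :=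
  ∑ w, permRep ι w

theorem symmetrizer_mul_permRep (w : Equiv.Perm ι) :
    symmetrizer ι * permRep ι w = symmetrizer ι := by
  simp only [symmetrizer, Finset.sum_mul, ← map_mul]
  exact Equiv.sum_comp (Equiv.mulRight w) (fun v => permRep ι v)

theorem permRep_mul_symmetrizer (w : Equiv.Perm ι) :
    permRep ι w * symmetrizer ι = symmetrizer ι := by
  simp only [symmetrizer, Finset.mul_sum, ← map_mul]
  exact Equiv.sum_comp (Equiv.mulLeft w) (fun v => permRep ι v)

theorem permRep_mul_sum_dunkl_pow (k : ℂ) (r : ℕ) (w : Equiv.Perm ι) :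
    permRep ι w * ∑ i, dunkl k i ^ r = (∑ i, dunkl k i ^ r) * permRep ι w := by
  rw [Finset.mul_sum, Finset.sum_mul, ← Equiv.sum_comp w (fun i => dunkl k i ^ r * _)]
  refine Finset.sum_congr rfl fun i _ => ?_
  exact SemiconjBy.pow_right (show SemiconjBy _ _ _ from permRep_mul_dunkl k w i) r

theorem symmetrizer_apply_of_invariant {f : MvPolynomial ι ℂ} (hf : ∀ w, permRep ι w f = f) :
    symmetrizer ι f = Fintype.card (Equiv.Perm ι) • f := by
  simp [symmetrizer, hf]

theorem sum_dunkl_pow_commute (k : ℂ) (r s : ℕ) {f : MvPolynomial ι ℂ}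
    (hf : ∀ w, permRep ι w f = f) :
    (∑ i, dunkl k i ^ r) ((∑ i, dunkl k i ^ s) f) =
      (∑ i, dunkl k i ^ s) ((∑ i, dunkl k i ^ r) f) := by
  have hinv : ∀ (t : ℕ) (g : MvPolynomial ι ℂ), (∀ w, permRep ι w g = g) →
      ∀ w, permRep ι w ((∑ i, dunkl k i ^ t) g) = (∑ i, dunkl k i ^ t) g := by
    intro t g hg w
    rw [← Module.End.mul_apply, permRep_mul_sum_dunkl_pow, Module.End.mul_apply, hg]
  have : IsAddTorsionFree (Module.End ℂ (MvPolynomial ι ℂ)) := .of_isTorsionFree ℂ _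
  have : IsAddTorsionFree (MvPolynomial ι ℂ) := .of_isTorsionFree ℂ _
  have h := sum_pow_commute_on_invariants (dunkl k) (permRep ι) (permRep_mul_dunkl k)
    (symmetrizer ι) symmetrizer_mul_permRep permRep_mul_symmetrizer _
    (Algebra.commutes _) (fun i j l => Equiv.swap i j * Equiv.swap j l) (dunkl_commutator k) r s
  have h' := LinearMap.congr_fun h f
  simp only [Module.End.mul_apply, symmetrizer_apply_of_invariant hf, map_nsmul] at h'
  rw [symmetrizer_apply_of_invariant (hinv r _ (hinv s _ hf)),
    symmetrizer_apply_of_invariant (hinv s _ (hinv r _ hf))] at h'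
  -- The symmetrizer is not normalized: each of its two occurrences contributes a factor equal to
  -- the number of permutations.
  exact nsmul_right_injective Fintype.card_ne_zero (nsmul_right_injective Fintype.card_ne_zero h')

end Specialization

/-! ### Joint injectivity of the specializations -/

section Injectivity

theorem coeff_partialCoeff (f : LambdaBar) (l : ℕ) :
    (partialCoeff f).coeff l = partialP l f := by
  induction f using MvPolynomial.induction_on with
  | C a => simp [partialCoeff, partialP]
  | add f g hf hg => simp only [map_add, Polynomial.coeff_add, hf, hg, partialP, mul_add]
  | mul_X f m hf =>
    have h : partialCoeff (p m) = (m : LambdaBar[X]) * X ^ m := by simp [partialCoeff, p]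
    change (partialCoeff (f * p m)).coeff l = partialP l (f * p m)
    rw [Derivation.leibniz, h, Polynomial.coeff_add, Polynomial.coeff_smul, Polynomial.coeff_smul,
      hf, ← Polynomial.C_eq_natCast, Polynomial.coeff_C_mul_X_pow, partialP, partialP,
      Derivation.leibniz, MvPolynomial.pderiv_X, Pi.single_apply]
    simp only [smul_eq_mul, mul_add]
    split_ifs with h1 h2 h2
    · subst h1; ring
    · exact absurd h1.symm h2
    · exact absurd h2.symm h1
    · ring

/-- Induction on degree through the derivatives in `p l`, `l ≥ 1`. Vanishing is assumed only for
large `n` because passing to a derivative needs more variables than the degree of `partialCoeff f`.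
-/
theorem eq_zero_of_psumHom_of_degree_lt (d : ℕ) : ∀ f : LambdaBar,
    (∀ m ∈ f.support, m.degree < d) →
    (∃ N, ∀ n ≥ N, psumHom (Fin n) f = 0) → f = 0 := by
  induction d with
  | zero =>
    intro f hf _
    exact MvPolynomial.support_eq_empty.mp (Finset.eq_empty_of_forall_notMem
      fun m hm => absurd (hf m hm) (Nat.not_lt_zero _))
  | succ d ih =>
    rintro f hf ⟨N, hN⟩
    have hd : ∀ l, l ≠ 0 → MvPolynomial.pderiv l f = 0 := by
      intro l hl
      refine ih _ (fun m hm => ?_) ⟨max N ((partialCoeff f).natDegree + 1), fun n hn => ?_⟩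
      · rw [MvPolynomial.mem_support_iff, MvPolynomial.coeff_pderiv] at hm
        have h := hf (m + Finsupp.single l 1)
          (MvPolynomial.mem_support_iff.mpr (left_ne_zero_of_mul hm))
        rw [map_add, Finsupp.degree_single] at h
        omega
      · have h0 : (partialCoeff f).map (psumHom (Fin n) : LambdaBar →+* MvPolynomial (Fin n) ℂ)
            = 0 := by
          refine Polynomial.eq_zero_of_natDegree_lt_card_of_eval_eq_zero _
            (f := fun i : Fin n => MvPolynomial.X i) MvPolynomial.X_injective (fun i => ?_) ?_
          · have h := evalAt_partialCoeff i f
            rw [hN n (le_of_max_le_left hn), map_zero] at h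
            rw [Polynomial.eval_map]
            exact h
          · rw [Fintype.card_fin]
            exact (Polynomial.natDegree_map_le).trans_lt (le_of_max_le_right hn)
        have h1 := congrArg (fun q => q.coeff l) h0
        simp only [Polynomial.coeff_map, coeff_partialCoeff, partialP, Polynomial.coeff_zero,
          RingHom.coe_coe, map_mul, map_natCast] at h1
        exact (mul_eq_zero.mp h1).resolve_left (Nat.cast_ne_zero.mpr hl)
    have hvars : ∀ l ∈ f.vars, l = 0 := by
      intro l hl
      by_contra h0
      obtain ⟨m, hm, hlm⟩ := (MvPolynomial.mem_vars_iff_mem_support l).mp hl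
      have h := congrArg (MvPolynomial.coeff (m - Finsupp.single l 1)) (hd l h0)
      have hle : Finsupp.single l 1 ≤ m := by
        rw [Finsupp.single_le_iff]
        exact Nat.one_le_iff_ne_zero.mpr (Finsupp.mem_support_iff.mp hlm)
      rw [MvPolynomial.coeff_pderiv, tsub_add_cancel_of_le hle, MvPolynomial.coeff_zero] at h
      refine (mul_ne_zero (MvPolynomial.mem_support_iff.mp hm) ?_) h
      exact Nat.cast_add_one_ne_zero _
    -- Now `f` is a polynomial in `p 0` alone, and `p 0` specializes to `n`, so every large natural
    -- number is a root.
    set q : ℂ[X] := MvPolynomial.aeval (fun _ => X) f with hq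
    have hfq : f = Polynomial.aeval (p 0) q := by
      have h : (RingHom.id LambdaBar) f = ((Polynomial.aeval (p 0)).comp
          (MvPolynomial.aeval (fun _ : ℕ => (X : ℂ[X]))) : LambdaBar →ₐ[ℂ] LambdaBar).toRingHom f := by
        refine MvPolynomial.hom_congr_vars ?_ ?_ rfl
        · ext a
          simp [← MvPolynomial.algebraMap_eq]
        · intro l hl _
          simp [hvars l hl, p]
      exact h
    have hq0 : q = 0 := by
      refine Polynomial.eq_zero_of_infinite_isRoot q
        (((Set.Ici_infinite N).image (Nat.cast_injective (R := ℂ)).injOn).mono ?_)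
      rintro _ ⟨n, hn, rfl⟩
      have h := hN n hn
      rw [hfq, ← Polynomial.aeval_algHom_apply, psumHom_p] at h
      have h2 : (∑ i : Fin n, (MvPolynomial.X i : MvPolynomial (Fin n) ℂ) ^ 0) =
          algebraMap ℂ _ (n : ℂ) := by simp
      rw [h2, Polynomial.aeval_algebraMap_apply] at h
      simpa using h
    rw [hfq, hq0, map_zero]

theorem eq_zero_of_forall_psumHom_eq_zero {f : LambdaBar} (h : ∀ n, psumHom (Fin n) f = 0) :
    f = 0 :=
  eq_zero_of_psumHom_of_degree_lt (f.support.sup (fun m => m.degree) + 1) f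
    (fun _ hm => Nat.lt_succ_of_le (Finset.le_sup (f := fun m => m.degree) hm)) ⟨0, fun n _ => h n⟩

end Injectivity

theorem L_commute (k : ℂ) (r s : ℕ) : ⁅L k r, L k s⁆ = 0 := by
  rw [Ring.lie_def, sub_eq_zero]
  refine LinearMap.ext fun f => ?_
  rw [← sub_eq_zero]
  refine eq_zero_of_forall_psumHom_eq_zero fun n => ?_
  rw [map_sub, Module.End.mul_apply, Module.End.mul_apply, psumHom_L, psumHom_L, psumHom_L,
    psumHom_L, sum_dunkl_pow_commute k r s fun w => permRep_psumHom w f, sub_self]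

/-! ### The second operator as the CMS operator -/

section SecondOperator

theorem exists_partialP_bound (f : LambdaBar) : ∃ N : ℕ, (∀ a, N < a → partialP a f = 0) ∧
    ∀ a b, N < a → partialP a (partialP b f) = 0 := by
  obtain ⟨n, hn⟩ := exists_partialP_eq_zero f
  choose m hm using fun b : ℕ => exists_partialP_eq_zero (partialP b f)
  refine ⟨max n ((Finset.range (n + 1)).sup m), fun a ha => hn a (by omega), fun a b ha => ?_⟩
  rcases lt_or_ge n b with hb | hb
  · rw [hn b hb]
    simp [partialP]
  · have h : m b ≤ (Finset.range (n + 1)).sup m :=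
      Finset.le_sup (f := m) (Finset.mem_range.mpr (by omega))
    exact hm b a (by omega)

theorem finsum_pnat_eq_sum {M : Type*} [AddCommMonoid M] (g : ℕ → M) (n : ℕ)
    (h : ∀ a, n < a → g a = 0) : ∑ᶠ a : ℕ+, g a = ∑ a ∈ Finset.Icc 1 n, g a := by
  rw [finsum_eq_sum_of_support_subset (fun a : ℕ+ => g a)
    (s := (Finset.Icc 1 n).subtype (fun a => 0 < a))]
  · refine (Finset.sum_subtype_eq_sum_filter g).trans (Finset.sum_congr ?_ fun _ _ => rfl)
    refine Finset.filter_true_of_mem fun a ha => ?_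
    exact (Finset.mem_Icc.mp ha).1
  · intro a ha
    exact Finset.mem_coe.mpr (Finset.mem_subtype.mpr (Finset.mem_Icc.mpr
      ⟨a.2, not_lt.mp fun h' => ha (h _ h')⟩))

theorem finsum_pnat_prod_eq_sum {M : Type*} [AddCommMonoid M] (g : ℕ → ℕ → M) (n : ℕ)
    (ha : ∀ a b, n < a → g a b = 0) (hb : ∀ a b, n < b → g a b = 0)
    (hf : (Function.support fun ab : ℕ+ × ℕ+ => g ab.1 ab.2).Finite) :
    ∑ᶠ ab : ℕ+ × ℕ+, g ab.1 ab.2 = ∑ a ∈ Finset.Icc 1 n, ∑ b ∈ Finset.Icc 1 n, g a b := by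
  rw [finsum_curry _ hf, ← finsum_pnat_eq_sum _ n fun a h => Finset.sum_eq_zero fun b _ => ha a b h]
  exact finsum_congr fun a => finsum_pnat_eq_sum (g a) n (hb a)

theorem partialCoeff_eq_sum {f : LambdaBar} {N : ℕ} (hN : ∀ a, N < a → partialP a f = 0) :
    partialCoeff f = ∑ l ∈ Finset.Icc 1 N, monomial l (partialP l f) := by
  ext1 l
  rw [coeff_partialCoeff, Polynomial.finsetSum_coeff]
  simp only [Polynomial.coeff_monomial, Finset.sum_ite_eq', Finset.mem_Icc]
  split_ifs with h
  · rfl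
  · rcases Nat.eq_zero_or_pos l with rfl | hl
    · simp [partialP]
    · exact hN l (by omega)

theorem E_monomial (l : ℕ) (f : LambdaBar) : E (monomial l f) = p l * f := by
  simp [E, Polynomial.lsum_apply, Polynomial.sum_monomial_index, mul_comm]

theorem E_C_mul_X_pow (l : ℕ) (f : LambdaBar) : E (X ^ l * C f) = p l * f := by
  rw [mul_comm, Polynomial.C_mul_X_pow_eq_monomial, E_monomial]

theorem E_deltaPow {l : ℕ} (hl : 1 ≤ l) : E (deltaPow l) =
    2 * (p l * p 0) + 2 * ∑ i ∈ Finset.Ico 1 l, p (l - i) * p i - 2 * ((l : LambdaBar) * p l) := by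
  have h : deltaPow l = X ^ l * C (p 0) + (2 : LambdaBar) • ∑ i ∈ Finset.Ico 1 l,
      X ^ (l - i) * C (p i) + X ^ 0 * C (p l) - (2 * (l : LambdaBar)) • (X ^ l * C 1) := by
    rw [deltaPow, if_neg (by omega), Polynomial.smul_eq_C_mul, Polynomial.smul_eq_C_mul]
    have h2 : (C 2 : LambdaBar[X]) = 2 := map_ofNat C 2
    simp [mul_assoc, h2]
  rw [h]
  simp only [map_sub, map_add, map_smul, map_sum, E_C_mul_X_pow, smul_eq_mul]
  ring

theorem D_apply (k : ℂ) (g : LambdaBar[X]) :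
    D k g = partialD g - (1 / 2 * k) • delta g := rfl

theorem E_smul (a : ℂ) (g : LambdaBar[X]) : E (a • g) = a • E g :=
  (E.restrictScalars ℂ).map_smul a g

theorem E_D (k : ℂ) (g : LambdaBar[X]) :
    E (D k g) = E (partialD g) - (1 / 2 * k) • E (delta g) := by
  rw [D_apply, map_sub, E_smul]

theorem L_two (k : ℂ) (f : LambdaBar) : L k 2 f = E (D k (D k (C f))) := rfl

/-- Under `E` the two end terms `x ^ l p_0` and `p_l` of `deltaPow l` coincide, so all terms carry a
factor 2, which cancels the 1/2 in `D k`. -/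
theorem E_D_monomial (k : ℂ) {l N : ℕ} (hl : 1 ≤ l) {g : LambdaBar}
    (hN : ∀ a, N < a → partialP a g = 0) :
    E (D k (monomial l g)) = (l : LambdaBar) * p l * g +
      ∑ m ∈ Finset.Icc 1 N, p (m + l) * partialP m g -
      k • (p 0 * (p l * g) + ∑ i ∈ Finset.Ico 1 l, p (l - i) * p i * g -
        (l : LambdaBar) * p l * g) := by
  have h1 : partialD (monomial l g) =
      (l : LambdaBar) • monomial l g + ∑ m ∈ Finset.Icc 1 N, monomial (m + l) (partialP m g) := by
    change partialLin (monomial l g) = _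
    rw [partialLin_monomial, partialCoeff_eq_sum hN, Finset.mul_sum, Polynomial.smul_eq_C_mul,
      ← Polynomial.C_mul_X_pow_eq_monomial]
    congr 1
    · simp only [map_natCast]
      ring
    · refine Finset.sum_congr rfl fun m _ => ?_
      rw [Polynomial.X_pow_mul_monomial]
  have h2 : delta (monomial l g) = g • deltaPow l := by
    simp [delta, Polynomial.lsum_apply, Polynomial.sum_monomial_index]
  have h3 := E_D k (monomial l g)
  rw [h3, h1, h2, map_add, map_smul, map_smul, map_sum, E_deltaPow hl]
  simp only [E_monomial, smul_eq_mul, ← Finset.sum_mul]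
  have h4 : ∀ z : LambdaBar, (1 / 2 * k) • (2 * z) = k • z := by
    intro z
    rw [two_mul, ← two_smul ℂ z, smul_smul]
    congr 1
    ring
  rw [← h4]
  refine congrArg₂ (· - ·) ?_ (congrArg (fun z => (1 / 2 * k) • z) ?_)
  · ring
  · ring

/-- Substitution `l = a + b`, `i = b`; the pairs with `a + b > N` in the square contribute zero. -/
theorem sum_reindex {N : ℕ} {M : Type*} [AddCommMonoid M] (h : ℕ → ℕ → ℕ → M)
    (h0 : ∀ a b l, N < l → h a b l = 0) :
    ∑ a ∈ Finset.Icc 1 N, ∑ b ∈ Finset.Icc 1 N, h a b (a + b) =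
      ∑ l ∈ Finset.Icc 1 N, ∑ i ∈ Finset.Ico 1 l, h (l - i) i l := by
  have h1 : ∑ l ∈ Finset.Icc 1 N, ∑ i ∈ Finset.Ico 1 l, h (l - i) i l =
      ∑ i ∈ Finset.Icc 1 N, ∑ l ∈ Finset.Ioc i N, h (l - i) i l :=
    Finset.sum_comm' (by
      intro x y
      simp only [Finset.mem_Icc, Finset.mem_Ico, Finset.mem_Ioc]
      omega)
  rw [Finset.sum_comm, h1]
  refine Finset.sum_congr rfl fun i hi => (Finset.sum_of_injOn (fun l => l - i) ?_ ?_ ?_ ?_).symm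
  · intro x hx y hy hxy
    simp only [Finset.coe_Ioc, Set.mem_Ioc] at hx hy hxy
    omega
  · intro x hx
    simp only [Finset.coe_Ioc, Set.mem_Ioc, Finset.coe_Icc, Set.mem_Icc] at hx ⊢
    omega
  · intro a ha hna
    refine h0 _ _ _ ?_
    by_contra hlt
    refine hna ⟨a + i, ?_, by simp⟩
    simp only [Finset.mem_Icc, Finset.coe_Ioc, Set.mem_Ioc] at ha ⊢
    omega
  · intro l hl
    simp only [Finset.mem_Ioc] at hl
    rw [Nat.sub_add_cancel hl.1.le]

theorem L_two_eq_cmsInfinity (k : ℂ) (f : LambdaBar) : L k 2 f = cmsInfinity k f := by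
  obtain ⟨N, hN, hN'⟩ := exists_partialP_bound f
  -- `delta` kills `C f`, so the first application of `D k` is free of `k`.
  have hD : D k (C f) = ∑ l ∈ Finset.Icc 1 N, monomial l (partialP l f) := by
    have h1 : partialD (C f) = partialCoeff f := by
      change partialLin (monomial 0 f) = _
      rw [partialLin_monomial]
      simp
    have h2 : delta (C f) = 0 := by
      change delta (monomial 0 f) = 0
      simp [delta, Polynomial.lsum_apply, deltaPow]
    rw [← partialCoeff_eq_sum hN, ← h1, D_apply, h2, smul_zero, sub_zero]
  have hpp : ∀ a b, N < b → partialP a (partialP b f) = 0 := by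
    intro a b hb
    rw [hN b hb]
    simp [partialP]
  rw [L_two, hD, map_sum, map_sum, Finset.sum_congr rfl fun l hl =>
    E_D_monomial k (Finset.mem_Icc.mp hl).1 fun a ha => hN' a l ha]
  have s1 := finsum_pnat_prod_eq_sum (fun a b => p (a + b) * partialP a (partialP b f)) N
    (fun a b h => by rw [hN' a b h, mul_zero]) (fun a b h => by rw [hpp a b h, mul_zero])
    (cms_finite₁ f)
  have s2 := finsum_pnat_prod_eq_sum (fun a b => p a * p b * partialP (a + b) f) N
    (fun a b h => by rw [hN _ (by omega), mul_zero])
    (fun a b h => by rw [hN _ (by omega), mul_zero]) (cms_finite₂ f)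
  have s3 := finsum_pnat_eq_sum (fun a => (a : LambdaBar) * p a * partialP a f) N
    (fun a h => by rw [hN a h, mul_zero])
  have s4 := finsum_pnat_eq_sum (fun a => p a * partialP a f) N
    (fun a h => by rw [hN a h, mul_zero])
  rw [sum_reindex (fun a b l => p a * p b * partialP l f)
    (fun a b l h => by rw [hN l h, mul_zero])] at s2
  rw [Finset.sum_comm] at s1
  unfold cmsInfinity
  rw [s1, s2, s3, s4]
  simp only [Finset.sum_sub_distrib, Finset.sum_add_distrib, ← Finset.smul_sum, ← Finset.mul_sum,
    add_smul, one_smul, smul_add, smul_sub]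
  abel

end SecondOperator

end DunklHeckman

theorem mainTheorem5 (k : ℂ) :
    (∀ r s : ℕ, ⁅DunklHeckman.L k r, DunklHeckman.L k s⁆ = 0) ∧
      (∀ f : DunklHeckman.LambdaBar,
        DunklHeckman.L k 2 f = DunklHeckman.cmsInfinity k f) :=
  ⟨DunklHeckman.L_commute k, DunklHeckman.L_two_eq_cmsInfinity k⟩
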